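/- Let $\tau\in\mathbb C$ with $\operatorname{Im}\tau>0$, and put $q=e^{i\pi\tau}$ and $q^{-1/\tau^2}:=e^{-i\pi/\tau}$, so that both have modulus less than $1$. Write $(a;b)_\infty=\prod_{n\ge 0}(1-ab^n)$ for $|b|<1$, and let $$\gamma(z)=\frac{(q^2e^{-2i\pi z};q^2)_\infty}{(e^{-2i\pi z/\tau};q^{-2/\tau^2})_\infty}.$$ Then $\gamma(1)$ is well defined (the two products converge and the denominator does not vanish at $z=1$), and $$\gamma(1)=\frac{(q^2;q^2)_\infty}{(q^{-2/\tau^2};q^{-2/\tau^2})_\infty}=i^{5/6}\,\tau^{-1/2}\,\exp\!\left(-\frac{i\pi(1+\tau)^2}{12\,\tau}\right),$$ where $i^{5/6}=e^{5i\pi/12}$ and $\tau^{-1/2}$ are principal values. Moreover, with the Dedekind eta function $\eta(\tau)=e^{i\pi\tau/12}\prod_{n\ge1}(1-e^{2i\pi n\tau})$, one has $\eta(-1/\tau)\neq0$ and $$\gamma(1)=\frac{e^{-i\pi\tau/12}\,\eta(\tau)}{e^{i\pi/(12\tau)}\,\eta(-1/\tau)},$$ so that the evaluation of $\gamma(1)$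 is equivalent to the modular transformation law $$\eta(-1/\tau)=(-i\tau)^{1/2}\,\eta(\tau)$$ (principal square root), which therefore holds as well. -/

import Mathlib

/-- The infinite Pochhammer symbol `(a; b)_∞ = (1 - a)(1 - ab)(1 - ab²)⋯`. -/
noncomputable def qPochhammerInf (a b : ℂ) : ℂ :=
  ∏' n : ℕ, (1 - a * b ^ n)

/-- `q = e^{iπτ}`. -/
noncomputable def nome (τ : ℂ) : ℂ :=
  Complex.exp (Complex.I * Real.pi * τ)

/-- `q^{-1/τ²} = e^{-iπ/τ}`. -/
noncomputable def dualNome (τ : ℂ) : ℂ :=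
  Complex.exp (-(Complex.I * Real.pi / τ))

/-- The function
`γ(z) = (q² e^{-2iπz}; q²)_∞ / (e^{-2iπz/τ}; q^{-2/τ²})_∞`. -/
noncomputable def gammaTau (τ z : ℂ) : ℂ :=
  qPochhammerInf (nome τ ^ 2 * Complex.exp (-(2 * Complex.I * Real.pi * z))) (nome τ ^ 2) /
    qPochhammerInf (Complex.exp (-(2 * Complex.I * Real.pi * z / τ))) (dualNome τ ^ 2)

/-! At `z = 1` both products have the form `(Q; Q)_∞`, with `Q = e^{2πiτ}` above and `Q =
e^{2πi(-1/τ)}` below, so each is an elementary exponential times eta at `τ` or `-1/τ`. Since eta has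
no zeros on the upper half-plane, its inversion law, taken from Mathlib, cancels `η(τ)` and leaves
only exponentials and a square root. -/

open Complex in
theorem norm_exp_two_pi_I_mul_lt_one {τ : ℂ} (hτ : 0 < τ.im) : ‖cexp (2 * Real.pi * I * τ)‖ < 1 :=
  UpperHalfPlane.norm_exp_two_pi_I_lt_one ⟨τ, hτ⟩

theorem im_neg_one_div_pos {τ : ℂ} (hτ : 0 < τ.im) : 0 < (-1 / τ).im := by
  have hτ0 : τ ≠ 0 := by rintro rfl; simp at hτ
  rw [neg_div, Complex.neg_im, one_div, Complex.inv_im, neg_div, neg_neg]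
  exact div_pos hτ (Complex.normSq_pos.mpr hτ0)

open Complex in
theorem nome_sq (τ : ℂ) : nome τ ^ 2 = cexp (2 * Real.pi * I * τ) := by
  rw [nome, ← Complex.exp_nat_mul]
  congr 1
  push_cast
  ring

open Complex in
theorem dualNome_sq (τ : ℂ) : dualNome τ ^ 2 = cexp (2 * Real.pi * I * (-1 / τ)) := by
  rw [dualNome, ← Complex.exp_nat_mul]
  congr 1
  push_cast
  ring

theorem multipliable_one_sub_mul_pow {q : ℂ} (hq : ‖q‖ < 1) :
    Multipliable fun n : ℕ => 1 - q * q ^ n := by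
  simpa only [pow_succ'] using ModularForm.multipliable_one_sub_pow hq

open Complex in
/-- The eta function is `e^{iπτ/12} (e^{2πiτ}; e^{2πiτ})_∞`. -/
theorem eta_eq_exp_mul_qPochhammerInf (τ : ℂ) :
    ModularForm.eta τ = cexp (I * Real.pi * τ / 12) *
      qPochhammerInf (cexp (2 * Real.pi * I * τ)) (cexp (2 * Real.pi * I * τ)) := by
  rw [ModularForm.eta, qPochhammerInf]
  congr 1
  · rw [Function.Periodic.qParam]
    congr 1
    push_cast
    ring
  · exact tprod_congr fun n => by rw [ModularForm.eta_q_eq_pow, pow_succ']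

open Complex in
theorem qPochhammerInf_eq_exp_mul_eta (τ : ℂ) :
    qPochhammerInf (cexp (2 * Real.pi * I * τ)) (cexp (2 * Real.pi * I * τ)) =
      cexp (-(I * Real.pi * τ / 12)) * ModularForm.eta τ := by
  rw [eta_eq_exp_mul_qPochhammerInf, ← mul_assoc, ← Complex.exp_add, neg_add_cancel,
    Complex.exp_zero, one_mul]

open Complex in
/-- The principal square root of `-iτ` splits as `i^{-1/2} τ^{1/2}` on the upper half-plane. -/
theorem neg_I_mul_cpow_half {τ : ℂ} (hτ : 0 < τ.im) :
    (-I * τ) ^ (1 / 2 : ℂ) = (I ^ (1 / 2 : ℂ))⁻¹ * τ ^ (1 / 2 : ℂ) := by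
  have hτ0 : τ ≠ 0 := by rintro rfl; simp at hτ
  -- No branch jump: `arg (-I) + arg τ` lies in `[-π/2, π/2]`.
  have hlog : log (-I * τ) = log (-I) + log τ := by
    refine Complex.log_mul (neg_ne_zero.mpr I_ne_zero) hτ0 ?_
    have h₀ : 0 ≤ arg τ := arg_nonneg_iff.mpr hτ.le
    have h₁ := arg_le_pi τ
    have := Real.pi_pos
    rw [arg_neg_I]
    constructor <;> linarith
  rw [cpow_def_of_ne_zero (mul_ne_zero (neg_ne_zero.mpr I_ne_zero) hτ0), hlog,
    cpow_def_of_ne_zero I_ne_zero, cpow_def_of_ne_zero hτ0, ← Complex.exp_neg, ← Complex.exp_add,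
    log_neg_I, log_I]
  congr 1
  ring

/-- The modular transformation law of the eta function under `τ ↦ -1/τ`. -/
theorem eta_neg_one_div {τ : ℂ} (hτ : 0 < τ.im) :
    ModularForm.eta (-1 / τ) = (-Complex.I * τ) ^ (1 / 2 : ℂ) * ModularForm.eta τ := by
  -- Here the factor is split as `(√i)⁻¹ √τ`, hence the rewriting of `(-iτ)^{1/2}`.
  have h := ModularForm.eta_comp_eq_csqrt_I_inv (show τ ∈ UpperHalfPlane.upperHalfPlaneSet from hτ)
  rw [neg_I_mul_cpow_half hτ]
  simpa [Complex.sqrt, mul_assoc] using h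

open Complex in
/-- The value at `1` of `γ`, as a quotient of Pochhammer symbols. -/
theorem gammaTau_one (τ : ℂ) : gammaTau τ 1 =
    qPochhammerInf (nome τ ^ 2) (nome τ ^ 2) /
      qPochhammerInf (dualNome τ ^ 2) (dualNome τ ^ 2) := by
  have h₁ : cexp (-(2 * I * Real.pi * 1)) = 1 := by
    rw [Complex.exp_neg, mul_one, show 2 * I * Real.pi = 2 * Real.pi * I by ring,
      exp_two_pi_mul_I, inv_one]
  have h₂ : cexp (-(2 * I * Real.pi * 1 / τ)) = dualNome τ ^ 2 := by
    rw [dualNome_sq]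
    congr 1
    ring
  rw [gammaTau, h₁, h₂, mul_one]

open Complex in
/-- The value at `1` of `γ`, as a quotient of eta functions. -/
theorem gammaTau_one_eq_eta_div_eta (τ : ℂ) : gammaTau τ 1 =
    (cexp (-(I * Real.pi * τ / 12)) * ModularForm.eta τ) /
      (cexp (I * Real.pi / (12 * τ)) * ModularForm.eta (-1 / τ)) := by
  rw [gammaTau_one, nome_sq, dualNome_sq, qPochhammerInf_eq_exp_mul_eta,
    qPochhammerInf_eq_exp_mul_eta]
  congr 3
  field_simp

open Complex in
theorem gammaTau_one_eq_exp {τ : ℂ} (hτ : 0 < τ.im) : gammaTau τ 1 =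
    I ^ (5 / 6 : ℂ) * τ ^ (-(1 / 2) : ℂ) * cexp (-(I * Real.pi * (1 + τ) ^ 2 / (12 * τ))) := by
  have hτ0 : τ ≠ 0 := by rintro rfl; simp at hτ
  have hη : ModularForm.eta τ ≠ 0 := ModularForm.eta_ne_zero hτ
  rw [gammaTau_one_eq_eta_div_eta, eta_neg_one_div hτ, neg_I_mul_cpow_half hτ, ← mul_assoc,
    mul_div_mul_right _ _ hη]
  simp only [cpow_def_of_ne_zero I_ne_zero, cpow_def_of_ne_zero hτ0, log_I, ← Complex.exp_neg,
    ← Complex.exp_add, ← Complex.exp_sub]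
  -- The cross term of `(1 + τ)² / (12τ)` is `1/6`. The law supplies `i^{1/2} = e^{iπ/4}`, and `1/4
  -- + 1/6 = 5/12` accounts for `i^{5/6}`.
  congr 1
  field_simp
  ring

theorem mainTheorem7 (τ : ℂ) (hτ : 0 < τ.im) :
    -- the two infinite products defining `γ(1)` converge, and the denominator is nonzero
    Multipliable (fun n : ℕ => 1 - nome τ ^ 2 * (nome τ ^ 2) ^ n) ∧
    Multipliable (fun n : ℕ => 1 - dualNome τ ^ 2 * (dualNome τ ^ 2) ^ n) ∧
    qPochhammerInf (dualNome τ ^ 2) (dualNome τ ^ 2) ≠ 0 ∧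
    -- `γ(1)` as a quotient of Pochhammer symbols
    gammaTau τ 1 =
      qPochhammerInf (nome τ ^ 2) (nome τ ^ 2) /
        qPochhammerInf (dualNome τ ^ 2) (dualNome τ ^ 2) ∧
    -- its evaluation (principal branches of the powers)
    gammaTau τ 1 =
      Complex.I ^ (5 / 6 : ℂ) * τ ^ (-(1 / 2) : ℂ) *
        Complex.exp (-(Complex.I * Real.pi * (1 + τ) ^ 2 / (12 * τ))) ∧
    -- `γ(1)` through the Dedekind eta function
    ModularForm.eta (-1 / τ) ≠ 0 ∧
    gammaTau τ 1 =
      (Complex.exp (-(Complex.I * Real.pi * τ / 12)) * ModularForm.eta τ) /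
        (Complex.exp (Complex.I * Real.pi / (12 * τ)) * ModularForm.eta (-1 / τ)) ∧
    -- the equivalent modular transformation of the Dedekind eta function
    ModularForm.eta (-1 / τ) = (-Complex.I * τ) ^ (1 / 2 : ℂ) * ModularForm.eta τ := by
  have hτ' := im_neg_one_div_pos hτ
  have hη : ModularForm.eta (-1 / τ) ≠ 0 := ModularForm.eta_ne_zero hτ'
  refine ⟨?_, ?_, ?_, gammaTau_one τ, gammaTau_one_eq_exp hτ, hη, gammaTau_one_eq_eta_div_eta τ,
    eta_neg_one_div hτ⟩
  · rw [nome_sq]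
    exact multipliable_one_sub_mul_pow (norm_exp_two_pi_I_mul_lt_one hτ)
  · rw [dualNome_sq]
    exact multipliable_one_sub_mul_pow (norm_exp_two_pi_I_mul_lt_one hτ')
  · rw [dualNome_sq, qPochhammerInf_eq_exp_mul_eta]
    exact mul_ne_zero (Complex.exp_ne_zero _) hη
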